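/- Let \(L=\{(i,j,k)\in\mathbb{Z}^3 : i+j+k\equiv 0 \bmod 2\}\), and let \(\mathcal{H}\subseteq L\) satisfy: (1) if \((i,j,k)\in\mathcal{H}\), then \((i',j',k')\in\mathcal{H}\) for every \((i',j',k')\in L\) with \(|i'-i|+|j'-j|\le k'-k\); (2) for every \((i',j',k')\in\mathcal{H}\), the set \(\{(i,j,k)\in\mathcal{H} : |i'-i|+|j'-j|\le k'-k\}\) is finite. Let \(H_{\mathrm{init}}=\{(a,b,c)\in\mathcal{H} : (a,b,c-2)\notin\mathcal{H}\}\), let \(\alpha,\beta\) and \(x_{a,b,c}\), for \((a,b,c)\in H_{\mathrm{init}}\), be independent indeterminates, and let \(K\) be the field of rational functions in the \(x_{a,b,c}\) over \(\mathbb{Z}[\alpha,\beta]\) (the fraction field of \(\mathbb{Z}[\alpha,\beta][x_{a,b,c} : (a,b,c)\in H_{\mathrm{init}}]\)). Consider arrays \((y_{i,j,k})_{(i,j,k)\in\mathcal{H}}\) of elements of \(K\) with initial entries \(y_{a,b,c}=x_{a,b,c}\) for \((a,b,c)\in H_{\mathrm{init}}\) that satisfy the octahedron recurrence \[ y_{i,j,k}\,y_{i,j,k-2}=\alpha\,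 y_{i+1,j,k-1}\,y_{i-1,j,k-1}+\beta\, y_{i,j+1,k-1}\,y_{i,j-1,k-1} \] whenever \((i,j,k)\) and \((i,j,k-2)\) both lie in \(\mathcal{H}\). Then such an array exists, and in every such array each entry \(y_{i,j,k}\), \((i,j,k)\in\mathcal{H}\), is nonzero and is a Laurent polynomial in the initial entries \(y_{a,b,c}\), \((a,b,c)\in H_{\mathrm{init}}\), with coefficients in \(\mathbb{Z}[\alpha,\beta]\). -/

import Mathlib

noncomputable section

namespace Octahedron

/-- The lattice `L` of all `(i, j, k)` in `ℤ³` with `i + j + k` even. -/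
def evenLattice : Set (ℤ × ℤ × ℤ) :=
  {h | Even (h.1 + h.2.1 + h.2.2)}

/-- `InCone (i, j, k) (i', j', k')` says `|i' - i| + |j' - j| ≤ k' - k`: the second point lies in
the upward light cone of the first one. -/
def InCone (h h' : ℤ × ℤ × ℤ) : Prop :=
  |h'.1 - h.1| + |h'.2.1 - h.2.1| ≤ h'.2.2 - h.2.2

/-- The conditions on the indexing set `H` of the array. -/
structure IsIndexSet (H : Set (ℤ × ℤ × ℤ)) : Prop where
  subset_lattice : H ⊆ evenLattice
  cone_closed : ∀ h ∈ H, ∀ h' ∈ evenLattice, InCone h h' → h' ∈ H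
  finite_below : ∀ h' ∈ H, {h | h ∈ H ∧ InCone h h'}.Finite

/-- The set `H_init` of all `(a, b, c)` in `H` such that `(a, b, c - 2)` is not in `H`. -/
def initSet (H : Set (ℤ × ℤ × ℤ)) : Set (ℤ × ℤ × ℤ) :=
  {h | h ∈ H ∧ (h.1, h.2.1, h.2.2 - 2) ∉ H}

/-- The polynomial ring `ℤ[α, β]` in two indeterminates. -/
abbrev Coeff : Type := MvPolynomial (Fin 2) ℤ

/-- The field of rational functions over `ℤ[α, β]` in independent variables indexed by `H_init`. -/
abbrev RatField (H : Set (ℤ × ℤ × ℤ)) : Type :=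
  FractionRing (MvPolynomial (initSet H) Coeff)

/-- The indeterminate `α` as a rational function. -/
def alpha (H : Set (ℤ × ℤ × ℤ)) : RatField H :=
  algebraMap Coeff (RatField H) (MvPolynomial.X 0)

/-- The indeterminate `β` as a rational function. -/
def beta (H : Set (ℤ × ℤ × ℤ)) : RatField H :=
  algebraMap Coeff (RatField H) (MvPolynomial.X 1)

/-- The independent variable attached to the index `a` of an initial entry. -/
def initVar (H : Set (ℤ × ℤ × ℤ)) (a : initSet H) : RatField H :=
  algebraMap (MvPolynomial (initSet H) Coeff) (RatField H) (MvPolynomial.X a)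

/-- The Laurent polynomials with coefficients in `ℤ[α, β]` in the variables indexed by `H_init`,
as a subalgebra of the field of rational functions. -/
def laurentRing (H : Set (ℤ × ℤ × ℤ)) : Subalgebra Coeff (RatField H) :=
  Algebra.adjoin Coeff (Set.range (initVar H) ∪ Set.range (fun a => (initVar H a)⁻¹))

/-- `y`, restricted to `H`, is an array whose initial entries are the independent variables and
which satisfies the octahedron recurrence. If `(i, j, k)` and `(i, j, k - 2)` lie in an index set
`H`, then so do the other four indices in the recurrence. The values of `y` outside `H` play
no role. -/
structure IsOctahedronArray (H : Set (ℤ × ℤ × ℤ)) (y : ℤ × ℤ × ℤ → RatField H) : Prop where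
  init : ∀ a : initSet H, y a = initVar H a
  recurrence : ∀ i j k : ℤ, (i, j, k) ∈ H → (i, j, k - 2) ∈ H →
    y (i, j, k) * y (i, j, k - 2) =
      alpha H * y (i + 1, j, k - 1) * y (i - 1, j, k - 1) +
      beta H * y (i, j + 1, k - 1) * y (i, j - 1, k - 1)

end Octahedron

end

/-! Fix an entry at `t`. Only the finite set `D` of points below `t` matters, and induction on its
size proves the following for every nowhere zero solution over an arbitrary field: the entry at `t`
lies in the ring generated by α, β, the initial entries and their inverses
(`IsPast.mem_laurentSubring`). This generality is needed because the generic array of `D`,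
restricted to a smaller `D'`, is still a solution, but its initial entries need no longer be
independent variables. Conversely, a Laurent expansion of a generic entry specializes to every
solution, so it suffices to treat the generic array of `D`.

Let a be a minimal point of `D`. If a + (0,0,2) is not in `D`, dropping a creates no new initial
point. Otherwise dropping a replaces x_a by P / x_a, where P = α x_e x_w + β x_n x_s is prime. By
induction y_t is then a Laurent polynomial up to a power of P in the denominator. That power cancels
once y_t also has an expansion whose denominator survives a specialization killing P
(`mem_fractions_of_mem_sup_powers`). The specialization sends one neighbour of a to -1 and
everything else to 1.

If a is not the least point of `D`, the second expansion comes from dropping another minimal point.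
If it is, and t is not a + (0,0,2), it comes from dropping the six points below a + (0,0,2). The
delicate new initial entry is the one at a + (0,0,4): the recurrence divides by an entry that
specializes to 0, and `confinement_identity` shows that no pole arises.

Existence and nonvanishing follow from positivity when α, β and all variables are set to 1. -/

namespace Octahedron

/-! ### Denominators and specializations of fractions -/

section Fractions

variable {R K F : Type*} [CommRing R] [Field K] [Algebra R K] [Field F]

/-- The subring of all elements of `K` that can be written with a denominator in `T`. -/
def fractionsWithDenom (K : Type*) [Field K] [Algebra R K] (T : Submonoid R) : Subring K where
  carrier := {u | ∃ s ∈ T, ∃ r : R, u * algebraMap R K s = algebraMap R K r}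
  one_mem' := ⟨1, T.one_mem, 1, by simp⟩
  zero_mem' := ⟨1, T.one_mem, 0, by simp⟩
  add_mem' := by
    rintro u v ⟨s, hs, r, h⟩ ⟨s', hs', r', h'⟩
    refine ⟨s * s', T.mul_mem hs hs', r * s' + r' * s, ?_⟩
    simp only [map_mul, map_add, ← h, ← h']
    ring
  mul_mem' := by
    rintro u v ⟨s, hs, r, h⟩ ⟨s', hs', r', h'⟩
    refine ⟨s * s', T.mul_mem hs hs', r * r', ?_⟩
    simp only [map_mul, ← h, ← h']
    ring
  neg_mem' := by
    rintro u ⟨s, hs, r, h⟩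
    exact ⟨s, hs, -r, by simp [← h]⟩

theorem algebraMap_mem_fractionsWithDenom (T : Submonoid R) (r : R) :
    algebraMap R K r ∈ fractionsWithDenom K T := ⟨1, T.one_mem, r, by simp⟩

theorem inv_algebraMap_mem_fractionsWithDenom {T : Submonoid R} {s : R} (hs : s ∈ T) :
    (algebraMap R K s)⁻¹ ∈ fractionsWithDenom K T := by
  by_cases h : algebraMap R K s = 0
  · rw [h, inv_zero]
    exact Subring.zero_mem _
  · exact ⟨s, hs, 1, by simp [h]⟩

/-- A fraction `u` over `R` takes the value `v` when `R` is specialized along `φ`. -/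
def SpecializesTo (φ : R →+* F) (u : K) (v : F) : Prop :=
  ∃ p q : R, φ q ≠ 0 ∧ u * algebraMap R K q = algebraMap R K p ∧ v * φ q = φ p

namespace SpecializesTo

variable {φ : R →+* F} {u u' : K} {v v' : F}

theorem of_algebraMap (φ : R →+* F) (r : R) : SpecializesTo φ (algebraMap R K r) (φ r) :=
  ⟨r, 1, by simp, by simp, by simp⟩

theorem add (h : SpecializesTo φ u v) (h' : SpecializesTo φ u' v') :
    SpecializesTo φ (u + u') (v + v') := by
  obtain ⟨p, q, hq, e, f⟩ := h
  obtain ⟨p', q', hq', e', f'⟩ := h'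
  refine ⟨p * q' + p' * q, q * q', by simp [hq, hq'], ?_, ?_⟩
  · simp only [map_mul, map_add, ← e, ← e']
    ring
  · simp only [map_mul, map_add, ← f, ← f']
    ring

theorem mul (h : SpecializesTo φ u v) (h' : SpecializesTo φ u' v') :
    SpecializesTo φ (u * u') (v * v') := by
  obtain ⟨p, q, hq, e, f⟩ := h
  obtain ⟨p', q', hq', e', f'⟩ := h'
  refine ⟨p * p', q * q', by simp [hq, hq'], ?_, ?_⟩
  · simp only [map_mul, ← e, ← e']
    ring
  · simp only [map_mul, ← f, ← f']
    ring

variable [FaithfulSMul R K]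

/-- Cross multiplication takes place in `R` and survives `φ`, so any representation of `u`
constrains `v`, even one with `φ s = 0`. In particular the value is unique. -/
theorem eq_of_mul_eq (h : SpecializesTo φ u v) {r s : R}
    (e : u * algebraMap R K s = algebraMap R K r) : v * φ s = φ r := by
  obtain ⟨p, q, hq, e', f⟩ := h
  have key : r * q = p * s := by
    apply FaithfulSMul.algebraMap_injective R K
    simp only [map_mul, ← e, ← e']
    ring
  have := congrArg φ key
  simp only [map_mul, ← f] at this
  apply mul_right_cancel₀ hq
  rw [this]
  ring

theorem ne_zero (h : SpecializesTo φ u v) (hv : v ≠ 0) : u ≠ 0 := by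
  rintro rfl
  apply hv
  simpa using h.eq_of_mul_eq (r := 0) (s := 1) (by simp)

theorem inv (h : SpecializesTo φ u v) (hv : v ≠ 0) : SpecializesTo φ u⁻¹ v⁻¹ := by
  have hu := h.ne_zero hv
  obtain ⟨p, q, hq, e, f⟩ := h
  refine ⟨q, p, ?_, ?_, ?_⟩
  · rw [← f]
    exact mul_ne_zero hv hq
  · rw [← e, inv_mul_cancel_left₀ hu]
  · rw [← f, inv_mul_cancel_left₀ hv]

theorem of_mul (h : SpecializesTo φ (u * u') v) (h' : SpecializesTo φ u' v') (hv' : v' ≠ 0) :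
    SpecializesTo φ u (v * v'⁻¹) := by
  have := h.mul (h'.inv hv')
  rwa [mul_inv_cancel_right₀ (h'.ne_zero hv')] at this

end SpecializesTo

/-- The elements of `R` that do not vanish under the specialization `φ`. -/
def nonvanishing (φ : R →+* F) : Submonoid R := (nonZeroDivisors F).comap φ

theorem mem_nonvanishing {φ : R →+* F} {r : R} : r ∈ nonvanishing φ ↔ φ r ≠ 0 := by
  simp [nonvanishing]

theorem SpecializesTo.mem_fractions {φ : R →+* F} {u : K} {v : F} (h : SpecializesTo φ u v) :
    u ∈ fractionsWithDenom K (nonvanishing φ) := by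
  obtain ⟨p, q, hq, e, -⟩ := h
  exact ⟨q, mem_nonvanishing.2 hq, p, e⟩

/-- A power of a prime in the denominator may be dropped if the fraction is also regular at a
specialization killing that prime but none of the other denominators. -/
theorem mem_fractions_of_mem_sup_powers [IsDomain R] [FaithfulSMul R K] {M : Submonoid R} {P : R}
    (hP : Prime P) {φ : R →+* F} (hφ : φ P = 0) {u : K}
    (h₁ : u ∈ fractionsWithDenom K (M ⊔ Submonoid.powers P))
    (h₂ : u ∈ fractionsWithDenom K (nonvanishing φ)) : u ∈ fractionsWithDenom K M := by
  obtain ⟨s, hs, r, e⟩ := h₁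
  obtain ⟨q, hq, t, f⟩ := h₂
  obtain ⟨m, hm, _, ⟨n, rfl⟩, rfl⟩ := Submonoid.mem_sup.1 hs
  have hinj := FaithfulSMul.algebraMap_injective R K
  have hqP : ¬ P ∣ q := by
    rintro ⟨c, rfl⟩
    exact mem_nonvanishing.1 hq (by simp [hφ])
  have key : r * q = t * m * P ^ n := by
    apply hinj
    simp only [map_mul, ← e, ← f]
    ring
  -- The prime `P` does not divide `q`, so all of `P ^ n` divides `r`.
  obtain ⟨r', rfl⟩ := hP.pow_dvd_of_dvd_mul_right n hqP ⟨t * m, by rw [key]; ring⟩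
  refine ⟨m, hm, r', ?_⟩
  have hPn : algebraMap R K (P ^ n) ≠ 0 := by
    rw [Ne, map_eq_zero_iff _ hinj]
    exact pow_ne_zero _ hP.ne_zero
  apply mul_right_cancel₀ hPn
  simp only [map_mul] at e ⊢
  rw [mul_assoc, e, mul_comm]

end Fractions

/-! ### Exchange polynomials and their primality -/

section Exchange

open MvPolynomial

variable {σ : Type*} {F : Type*} [CommRing F]

/-- Evaluation of polynomials over `ℤ[α, β]` at given values of `α`, `β` and the variables. -/
noncomputable def evalAt (α β : F) (x : σ → F) : MvPolynomial σ Coeff →+* F :=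
  eval₂Hom (eval₂Hom (Int.castRingHom F) ![α, β]) x

@[simp] theorem evalAt_X (α β : F) (x : σ → F) (a : σ) : evalAt α β x (X a) = x a := by
  simp [evalAt]

@[simp] theorem evalAt_alpha (α β : F) (x : σ → F) : evalAt α β x (C (X 0)) = α := by
  simp [evalAt]

@[simp] theorem evalAt_beta (α β : F) (x : σ → F) : evalAt α β x (C (X 1)) = β := by
  simp [evalAt]

/-- The numerator `α x_e x_w + β x_n x_s` of an exchange relation. -/
noncomputable def exchangePoly (e w n s : σ) : MvPolynomial σ Coeff :=
  C (X 0) * X e * X w + C (X 1) * X n * X s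

@[simp] theorem evalAt_exchangePoly (α β : F) (x : σ → F) (e w n s : σ) :
    evalAt α β x (exchangePoly e w n s) = α * x e * x w + β * x n * x s := by
  simp [exchangePoly]

theorem not_dvd_of_evalAt {p q : MvPolynomial σ Coeff} (α β : ℤ) (x : σ → ℤ)
    (hp : evalAt α β x p = 0) (hq : evalAt α β x q ≠ 0) : ¬ p ∣ q := by
  rintro ⟨c, rfl⟩
  exact hq (by simp [hp])

/-- The polynomial is linear in x_e, with coefficient α x_w coprime to the constant term β x_n x_s:
each of α and x_w vanishes at an integer point where the constant term does not. -/
theorem exchangePoly_prime {e w n s : σ} (hew : e ≠ w) (hen : e ≠ n) (hes : e ≠ s)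
    (hwn : w ≠ n) (hws : w ≠ s) : Prime (exchangePoly e w n s) := by
  classical
  rw [← irreducible_iff_prime]
  have hα : Irreducible (C (X 0) : MvPolynomial σ Coeff) :=
    ((prime_C_iff σ).2 X_prime).irreducible
  have hw : Irreducible (X w : MvPolynomial σ Coeff) := (X_prime (i := w)).irreducible
  have h1 : IsRelPrime (C (X 0) * X w : MvPolynomial σ Coeff) (C (X 1) * X n * X s) := by
    apply IsRelPrime.mul_left
    · rw [hα.isRelPrime_iff_not_dvd]
      exact not_dvd_of_evalAt 0 1 (fun _ => 1) (by simp) (by simp)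
    · rw [hw.isRelPrime_iff_not_dvd]
      exact not_dvd_of_evalAt 1 1 (fun a => if a = w then 0 else 1) (by simp)
        (by simp [hwn.symm, hws.symm])
  have hne : (C (X 0) * X w : MvPolynomial σ Coeff) ≠ 0 := mul_ne_zero hα.ne_zero hw.ne_zero
  have hv1 : e ∉ (C (X 0) * X w : MvPolynomial σ Coeff).vars := fun h => by
    have := vars_mul _ _ h
    simp [vars_C, vars_X, hew] at this
  have hv2 : e ∉ (C (X 1) * X n * X s : MvPolynomial σ Coeff).vars := fun h => by
    rcases Finset.mem_union.1 (vars_mul _ _ h) with h | h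
    · have := vars_mul _ _ h
      simp [vars_C, vars_X, hen] at this
    · simp [vars_X, hes] at h
  have heq : exchangePoly e w n s = C (X 0) * X w * X e + C (X 1) * X n * X s := by
    simp only [exchangePoly]
    ring
  rw [heq]
  exact irreducible_mul_X_add _ _ e hne hv1 hv2 h1

end Exchange

/-! ### Solutions of the recurrence and induction along cones -/

section Arrays

variable {D : Set (ℤ × ℤ × ℤ)} {K : Type*} [Field K] {α β : K} {y : ℤ × ℤ × ℤ → K}

theorem InCone.refl (g : ℤ × ℤ × ℤ) : InCone g g := by simp [InCone]

theorem InCone.trans {g g' g'' : ℤ × ℤ × ℤ} (h : InCone g g') (h' : InCone g' g'') :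
    InCone g g'' := by
  simp only [InCone] at *
  grind

theorem InCone.antisymm {g g' : ℤ × ℤ × ℤ} (h : InCone g g') (h' : InCone g' g) : g = g' := by
  obtain ⟨i, j, k⟩ := g
  obtain ⟨i', j', k'⟩ := g'
  simp only [InCone] at *
  simp only [Prod.mk.injEq]
  grind

theorem inCone_iff {i j k i' j' k' : ℤ} : InCone (i, j, k) (i', j', k') ↔
    i' - i + (j' - j) ≤ k' - k ∧ i' - i - (j' - j) ≤ k' - k ∧
      -(i' - i) + (j' - j) ≤ k' - k ∧ -(i' - i) - (j' - j) ≤ k' - k := by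
  simp only [InCone]
  grind

/-- A set on which the octahedron recurrence determines an array from its initial entries. -/
structure IsRecurrenceDomain (D : Set (ℤ × ℤ × ℤ)) : Prop where
  neighbors : ∀ i j k : ℤ, (i, j, k) ∈ D → (i, j, k - 2) ∈ D →
    (i + 1, j, k - 1) ∈ D ∧ (i - 1, j, k - 1) ∈ D ∧ (i, j + 1, k - 1) ∈ D ∧ (i, j - 1, k - 1) ∈ D
  finite_below : ∀ g ∈ D, {g' | g' ∈ D ∧ InCone g' g}.Finite

/-- The measure for induction along the recurrence and for the recursion defining `genericArray`. -/
theorem IsRecurrenceDomain.ncard_lt (hD : IsRecurrenceDomain D) {g g' : ℤ × ℤ × ℤ} (hg : g ∈ D)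
    (h : InCone g' g) (hne : g' ≠ g) :
    {p | p ∈ D ∧ InCone p g'}.ncard < {p | p ∈ D ∧ InCone p g}.ncard := by
  apply Set.ncard_lt_ncard _ (hD.finite_below g hg)
  refine ⟨fun p hp => ⟨hp.1, hp.2.trans h⟩, fun hs => hne ?_⟩
  exact h.antisymm (hs ⟨hg, InCone.refl g⟩).2

/-- Induction along the recurrence. -/
theorem IsRecurrenceDomain.induction (hD : IsRecurrenceDomain D) {p : ℤ × ℤ × ℤ → Prop}
    (init : ∀ a : initSet D, p a)
    (step : ∀ i j k : ℤ, (i, j, k) ∈ D → (i, j, k - 2) ∈ D → p (i, j, k - 2) →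
      p (i + 1, j, k - 1) → p (i - 1, j, k - 1) → p (i, j + 1, k - 1) → p (i, j - 1, k - 1) →
      p (i, j, k)) : ∀ g ∈ D, p g := by
  intro g
  induction hn : {p | p ∈ D ∧ InCone p g}.ncard using Nat.strong_induction_on generalizing g with
  | _ n ih =>
    intro hg
    subst hn
    obtain ⟨i, j, k⟩ := g
    by_cases h2 : (i, j, k - 2) ∈ D
    · obtain ⟨h3, h4, h5, h6⟩ := hD.neighbors i j k hg h2
      have key : ∀ g' ∈ D, InCone g' (i, j, k) → g' ≠ (i, j, k) → p g' := fun g' hg' hc hne =>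
        ih _ (hD.ncard_lt hg hc hne) g' rfl hg'
      exact step i j k hg h2 (key _ h2 (by simp [InCone]) (by simp))
        (key _ h3 (by simp [InCone]) (by simp)) (key _ h4 (by simp [InCone]) (by simp))
        (key _ h5 (by simp [InCone]) (by simp)) (key _ h6 (by simp [InCone]) (by simp))
    · exact init ⟨(i, j, k), hg, h2⟩

/-- `y` is nonzero on `D` and satisfies the octahedron recurrence with coefficients `α`, `β`. -/
structure IsSolution (D : Set (ℤ × ℤ × ℤ)) (α β : K) (y : ℤ × ℤ × ℤ → K) : Prop where
  ne_zero : ∀ g ∈ D, y g ≠ 0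
  recurrence : ∀ i j k : ℤ, (i, j, k) ∈ D → (i, j, k - 2) ∈ D →
    y (i, j, k) * y (i, j, k - 2) =
      α * y (i + 1, j, k - 1) * y (i - 1, j, k - 1) + β * y (i, j + 1, k - 1) * y (i, j - 1, k - 1)

theorem IsSolution.mono {D' : Set (ℤ × ℤ × ℤ)} (h : IsSolution D α β y) (hs : D' ⊆ D) :
    IsSolution D' α β y :=
  ⟨fun g hg => h.ne_zero g (hs hg), fun i j k h1 h2 => h.recurrence i j k (hs h1) (hs h2)⟩

/-- The subring generated by the coefficients and the initial entries and their inverses. -/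
def laurentSubring (D : Set (ℤ × ℤ × ℤ)) (α β : K) (y : ℤ × ℤ × ℤ → K) : Subring K :=
  Subring.closure ({α, β} ∪ (y '' initSet D ∪ (fun g => (y g)⁻¹) '' initSet D))

theorem laurentSubring_le {S : Subring K} (hα : α ∈ S) (hβ : β ∈ S)
    (h : ∀ g ∈ initSet D, y g ∈ S ∧ (y g)⁻¹ ∈ S) : laurentSubring D α β y ≤ S := by
  rw [laurentSubring, Subring.closure_le]
  rintro u ((rfl | rfl) | ⟨g, hg, rfl⟩ | ⟨g, hg, rfl⟩)
  exacts [hα, hβ, (h g hg).1, (h g hg).2]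

theorem alpha_mem_laurentSubring : α ∈ laurentSubring D α β y :=
  Subring.subset_closure (by simp)

theorem beta_mem_laurentSubring : β ∈ laurentSubring D α β y :=
  Subring.subset_closure (by simp)

theorem init_mem_laurentSubring {g : ℤ × ℤ × ℤ} (hg : g ∈ initSet D) :
    y g ∈ laurentSubring D α β y :=
  Subring.subset_closure (Or.inr (Or.inl ⟨g, hg, rfl⟩))

theorem init_inv_mem_laurentSubring {g : ℤ × ℤ × ℤ} (hg : g ∈ initSet D) :
    (y g)⁻¹ ∈ laurentSubring D α β y :=
  Subring.subset_closure (Or.inr (Or.inr ⟨g, hg, rfl⟩))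

theorem laurentSubring_mono {D' : Set (ℤ × ℤ × ℤ)} (h : initSet D' ⊆ initSet D) :
    laurentSubring D' α β y ≤ laurentSubring D α β y :=
  laurentSubring_le alpha_mem_laurentSubring beta_mem_laurentSubring fun _ hg =>
    ⟨init_mem_laurentSubring (h hg), init_inv_mem_laurentSubring (h hg)⟩

end Arrays

/-! ### The generic array and its specializations -/

section Generic

open MvPolynomial

variable {D : Set (ℤ × ℤ × ℤ)} {F : Type*} [Field F]

theorem algebraMap_alpha (D : Set (ℤ × ℤ × ℤ)) :
    algebraMap (MvPolynomial (initSet D) Coeff) (RatField D) (C (X 0)) = alpha D := by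
  rw [alpha, IsScalarTower.algebraMap_apply Coeff (MvPolynomial (initSet D) Coeff) (RatField D)]
  rfl

theorem algebraMap_beta (D : Set (ℤ × ℤ × ℤ)) :
    algebraMap (MvPolynomial (initSet D) Coeff) (RatField D) (C (X 1)) = beta D := by
  rw [beta, IsScalarTower.algebraMap_apply Coeff (MvPolynomial (initSet D) Coeff) (RatField D)]
  rfl

theorem specializesTo_alpha (α β : F) (x : initSet D → F) :
    SpecializesTo (evalAt α β x) (alpha D) α := by
  simpa [algebraMap_alpha] using
    SpecializesTo.of_algebraMap (K := RatField D) (evalAt α β x) (C (X 0))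

theorem specializesTo_beta (α β : F) (x : initSet D → F) :
    SpecializesTo (evalAt α β x) (beta D) β := by
  simpa [algebraMap_beta] using
    SpecializesTo.of_algebraMap (K := RatField D) (evalAt α β x) (C (X 1))

theorem specializesTo_initVar (α β : F) (x : initSet D → F) (a : initSet D) :
    SpecializesTo (evalAt α β x) (initVar D a) (x a) := by
  simpa [initVar] using
    SpecializesTo.of_algebraMap (K := RatField D) (evalAt α β x) (X a)

/-- The recurrence only adds, multiplies and divides positive rationals. It is assumed only where
the divisor is nonzero, so that the result applies to `genericArray` before its nonvanishing is
known. -/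
theorem exists_specializesTo_pos (hD : IsRecurrenceDomain D) {y : ℤ × ℤ × ℤ → RatField D}
    (init : ∀ a : initSet D, y a = initVar D a)
    (recurrence : ∀ i j k : ℤ, (i, j, k) ∈ D → (i, j, k - 2) ∈ D → y (i, j, k - 2) ≠ 0 →
      y (i, j, k) * y (i, j, k - 2) =
        alpha D * y (i + 1, j, k - 1) * y (i - 1, j, k - 1) +
        beta D * y (i, j + 1, k - 1) * y (i, j - 1, k - 1)) :
    ∀ g ∈ D, ∃ v : ℚ, 0 < v ∧ SpecializesTo (evalAt 1 1 fun _ : initSet D => (1 : ℚ)) (y g) v := by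
  refine hD.induction (p := fun g => ∃ v : ℚ, 0 < v ∧
    SpecializesTo (evalAt 1 1 fun _ : initSet D => (1 : ℚ)) (y g) v) ?_ ?_
  · intro a
    rw [init]
    exact ⟨1, one_pos, specializesTo_initVar 1 1 _ a⟩
  · rintro i j k hg hg2 ⟨v, hv, h⟩ ⟨v1, hv1, h1⟩ ⟨v2, hv2, h2⟩ ⟨v3, hv3, h3⟩ ⟨v4, hv4, h4⟩
    have hs := (((specializesTo_alpha 1 1 _).mul h1).mul h2).add
      (((specializesTo_beta 1 1 _).mul h3).mul h4)
    rw [← recurrence i j k hg hg2 (h.ne_zero hv.ne')] at hs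
    exact ⟨_, by positivity, hs.of_mul h hv.ne'⟩

theorem IsOctahedronArray.isSolution (hD : IsRecurrenceDomain D) {y : ℤ × ℤ × ℤ → RatField D}
    (hy : IsOctahedronArray D y) : IsSolution D (alpha D) (beta D) y where
  ne_zero g hg := by
    obtain ⟨v, hv, h⟩ := exists_specializesTo_pos hD hy.init
      (fun i j k h1 h2 _ => hy.recurrence i j k h1 h2) g hg
    exact h.ne_zero hv.ne'
  recurrence := hy.recurrence

open Classical in
/-- The array computed from the independent variables by means of the recurrence. -/
noncomputable def genericArray (hD : IsRecurrenceDomain D) : ℤ × ℤ × ℤ → RatField D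
  | (i, j, k) =>
    if _h : (i, j, k) ∈ D ∧ (i, j, k - 2) ∈ D then
      (alpha D * genericArray hD (i + 1, j, k - 1) * genericArray hD (i - 1, j, k - 1) +
        beta D * genericArray hD (i, j + 1, k - 1) * genericArray hD (i, j - 1, k - 1)) /
        genericArray hD (i, j, k - 2)
    else if h : (i, j, k) ∈ initSet D then initVar D ⟨(i, j, k), h⟩ else 0
termination_by g => {p | p ∈ D ∧ InCone p g}.ncard
decreasing_by
  all_goals exact hD.ncard_lt ‹_ ∧ _›.1 (by simp [InCone]) (by simp)

theorem isOctahedronArray_genericArray (hD : IsRecurrenceDomain D) :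
    IsOctahedronArray D (genericArray hD) := by
  have init : ∀ a : initSet D, genericArray hD a = initVar D a := by
    rintro ⟨⟨i, j, k⟩, h⟩
    rw [genericArray, dif_neg (fun h' => h.2 h'.2), dif_pos h]
  have recurrence : ∀ i j k : ℤ, (i, j, k) ∈ D → (i, j, k - 2) ∈ D →
      genericArray hD (i, j, k - 2) ≠ 0 →
      genericArray hD (i, j, k) * genericArray hD (i, j, k - 2) =
        alpha D * genericArray hD (i + 1, j, k - 1) * genericArray hD (i - 1, j, k - 1) +
        beta D * genericArray hD (i, j + 1, k - 1) * genericArray hD (i, j - 1, k - 1) := by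
    intro i j k h1 h2 h3
    conv_lhs => rw [genericArray, dif_pos ⟨h1, h2⟩]
    exact div_mul_cancel₀ _ h3
  refine ⟨init, fun i j k h1 h2 => recurrence i j k h1 h2 ?_⟩
  obtain ⟨v, hv, h⟩ := exists_specializesTo_pos hD init recurrence _ h2
  exact h.ne_zero hv.ne'

/-- The array of independent variables specializes to every other solution. -/
theorem IsOctahedronArray.specializesTo (hD : IsRecurrenceDomain D) {y : ℤ × ℤ × ℤ → RatField D}
    (hy : IsOctahedronArray D y) {α β : F} {z : ℤ × ℤ × ℤ → F} (hz : IsSolution D α β z) :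
    ∀ g ∈ D, SpecializesTo (evalAt α β fun a : initSet D => z a) (y g) (z g) := by
  refine hD.induction
    (p := fun g => SpecializesTo (evalAt α β fun a : initSet D => z a) (y g) (z g)) ?_ ?_
  · intro a
    rw [hy.init]
    exact specializesTo_initVar α β _ a
  · intro i j k hg hg2 h h1 h2 h3 h4
    have hs := (((specializesTo_alpha α β _).mul h1).mul h2).add
      (((specializesTo_beta α β _).mul h3).mul h4)
    rw [← hy.recurrence i j k hg hg2, ← hz.recurrence i j k hg hg2] at hs
    have := hs.of_mul h (hz.ne_zero _ hg2)
    rwa [mul_inv_cancel_right₀ (hz.ne_zero _ hg2)] at this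

/-- The monomials in the variables. -/
noncomputable def monomials (σ : Type*) : Submonoid (MvPolynomial σ Coeff) :=
  Submonoid.closure (Set.range X)

theorem evalAt_mem_laurentSubring {α β : F} {z : ℤ × ℤ × ℤ → F}
    (p : MvPolynomial (initSet D) Coeff) :
    evalAt α β (fun a : initSet D => z a) p ∈ laurentSubring D α β z := by
  induction p using MvPolynomial.induction_on with
  | C c =>
    induction c using MvPolynomial.induction_on with
    | C n => simp [evalAt]
    | add p q hp hq =>
      rw [map_add, map_add]
      exact add_mem hp hq
    | mul_X p n hp =>
      rw [map_mul, map_mul]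
      refine mul_mem hp ?_
      fin_cases n
      · simpa using alpha_mem_laurentSubring
      · simpa using beta_mem_laurentSubring
  | add p q hp hq =>
    rw [map_add]
    exact add_mem hp hq
  | mul_X p a hp =>
    rw [map_mul, evalAt_X]
    exact mul_mem hp (init_mem_laurentSubring a.2)

theorem inv_evalAt_mem_laurentSubring {α β : F} {z : ℤ × ℤ × ℤ → F}
    {m : MvPolynomial (initSet D) Coeff} (hm : m ∈ monomials (initSet D)) :
    (evalAt α β (fun a : initSet D => z a) m)⁻¹ ∈ laurentSubring D α β z := by
  induction hm using Submonoid.closure_induction with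
  | mem m hm =>
    obtain ⟨a, rfl⟩ := hm
    rw [evalAt_X]
    exact init_inv_mem_laurentSubring a.2
  | one => simp
  | mul p q _ _ hp hq =>
    rw [map_mul, mul_inv]
    exact mul_mem hp hq

theorem evalAt_monomial_ne_zero {σ : Type*} {α β : F} {x : σ → F} (hx : ∀ a, x a ≠ 0)
    {m : MvPolynomial σ Coeff} (hm : m ∈ monomials σ) : evalAt α β x m ≠ 0 := by
  induction hm using Submonoid.closure_induction with
  | mem m hm =>
    obtain ⟨a, rfl⟩ := hm
    simpa using hx a
  | one => simp
  | mul p q _ _ hp hq =>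
    rw [map_mul]
    exact mul_ne_zero hp hq

/-- A Laurent expansion of an entry of the generic array gives one for every other solution. -/
theorem IsSolution.mem_laurentSubring_of_generic (hD : IsRecurrenceDomain D)
    {y : ℤ × ℤ × ℤ → RatField D} (hy : IsOctahedronArray D y) {g : ℤ × ℤ × ℤ} (hg : g ∈ D)
    (h : y g ∈ fractionsWithDenom (RatField D) (monomials (initSet D)))
    {α β : F} {z : ℤ × ℤ × ℤ → F} (hz : IsSolution D α β z) :
    z g ∈ laurentSubring D α β z := by
  obtain ⟨m, hm, r, e⟩ := h
  have hne := evalAt_monomial_ne_zero (α := α) (β := β) (x := fun a : initSet D => z a)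
    (fun a => hz.ne_zero _ a.2.1) hm
  rw [(eq_mul_inv_iff_mul_eq₀ hne).2 ((hy.specializesTo hD hz g hg).eq_of_mul_eq e)]
  exact mul_mem (evalAt_mem_laurentSubring r) (inv_evalAt_mem_laurentSubring hm)

end Generic

/-! ### Finite pasts of a point and their initial points -/

section Past

variable {D : Set (ℤ × ℤ × ℤ)} {t : ℤ × ℤ × ℤ}

/-- `D` is a finite set of lattice points below `t`, closed under passing to lattice points between
a point of `D` and `t`. -/
structure IsPast (D : Set (ℤ × ℤ × ℤ)) (t : ℤ × ℤ × ℤ) : Prop where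
  top_mem : t ∈ D
  finite : D.Finite
  subset_lattice : D ⊆ evenLattice
  inCone_top : ∀ g ∈ D, InCone g t
  closed : ∀ g ∈ D, ∀ g' ∈ evenLattice, InCone g g' → InCone g' t → g' ∈ D

theorem IsPast.isRecurrenceDomain (hD : IsPast D t) : IsRecurrenceDomain D where
  neighbors i j k h h2 := by
    have he := hD.subset_lattice h
    have key : ∀ i' j' : ℤ, |i' - i| + |j' - j| = 1 → (i', j', k - 1) ∈ D := by
      intro i' j' h1
      refine hD.closed _ h2 _ ?_ ?_ (InCone.trans ?_ (hD.inCone_top _ h))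
      · simp only [evenLattice, Set.mem_ofPred_eq, Int.even_iff] at he ⊢
        grind
      · simp only [InCone]
        grind
      · simp only [InCone]
        grind
    exact ⟨key _ _ (by simp), key _ _ (by simp), key _ _ (by simp), key _ _ (by simp)⟩
  finite_below _ _ := hD.finite.subset fun _ h => h.1

theorem IsPast.restrict (hD : IsPast D t) {D' : Set (ℤ × ℤ × ℤ)} (hs : D' ⊆ D) (ht : t ∈ D')
    (hc : ∀ g ∈ D', ∀ g' ∈ D, InCone g g' → g' ∈ D') : IsPast D' t where
  top_mem := ht
  finite := hD.finite.subset hs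
  subset_lattice := hs.trans hD.subset_lattice
  inCone_top g hg := hD.inCone_top g (hs hg)
  closed g hg g' he h h' := hc g hg g' (hD.closed g (hs hg) g' he h h') h

/-- No other point of `D` lies below `a`. -/
def IsBottom (D : Set (ℤ × ℤ × ℤ)) (a : ℤ × ℤ × ℤ) : Prop :=
  a ∈ D ∧ ∀ g ∈ D, InCone g a → g = a

theorem exists_isBottom_of_finite {S : Set (ℤ × ℤ × ℤ)} (hS : S.Finite) (hne : S.Nonempty) :
    ∃ a, IsBottom S a := by
  obtain ⟨a, ha, hmin⟩ := Set.exists_min_image S (fun g => g.2.2) hS hne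
  refine ⟨a, ha, fun g hg hga => ?_⟩
  have := hmin g hg
  obtain ⟨i, j, k⟩ := g
  obtain ⟨i', j', k'⟩ := a
  simp only [InCone] at *
  simp only [Prod.mk.injEq]
  grind

theorem IsPast.diff_bottom (hD : IsPast D t) {a : ℤ × ℤ × ℤ} (ha : IsBottom D a) (hat : a ≠ t) :
    IsPast (D \ {a}) t := by
  refine hD.restrict Set.sdiff_subset ⟨hD.top_mem, fun h => hat h.symm⟩ ?_
  rintro g ⟨hg, hga⟩ g' hg' h
  refine ⟨hg', ?_⟩
  rintro rfl
  exact hga (ha.2 g hg h)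

theorem mem_initSet_diff {a b c : ℤ} {g : ℤ × ℤ × ℤ} (hg : g ∈ initSet (D \ {(a, b, c)})) :
    (g ∈ initSet D ∧ g ≠ (a, b, c)) ∨ (g = (a, b, c + 2) ∧ g ∈ D) := by
  obtain ⟨i, j, k⟩ := g
  obtain ⟨⟨h1, h2⟩, h3⟩ := hg
  by_cases h : (i, j, k - 2) ∈ D
  · right
    have : (i, j, k - 2) = (a, b, c) := by
      by_contra hne
      exact h3 ⟨h, hne⟩
    simp only [Prod.mk.injEq] at this ⊢
    exact ⟨by omega, h1⟩
  · exact Or.inl ⟨⟨h1, h⟩, h2⟩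

theorem IsBottom.mem_initSet {a : ℤ × ℤ × ℤ} (ha : IsBottom D a) : a ∈ initSet D := by
  refine ⟨ha.1, fun h => ?_⟩
  have := ha.2 _ h (by simp [InCone])
  obtain ⟨i, j, k⟩ := a
  simp at this

/-- The four neighbours of an exchangeable bottom point are initial. -/
theorem IsPast.neighbor_mem_initSet (hD : IsPast D t) {a b c : ℤ} (ha : IsBottom D (a, b, c))
    (ha2 : (a, b, c + 2) ∈ D) {i j : ℤ} (hij : |i - a| + |j - b| = 1) :
    (i, j, c + 1) ∈ initSet D := by
  have he := hD.subset_lattice ha.1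
  constructor
  · refine hD.closed _ ha.1 _ ?_ ?_ (InCone.trans ?_ (hD.inCone_top _ ha2))
    · simp only [evenLattice, Set.mem_ofPred_eq, Int.even_iff] at he ⊢
      grind
    · simp only [InCone]
      grind
    · simp only [InCone]
      grind
  · intro h
    have := ha.2 _ h (by simp only [InCone]; grind)
    simp only [Prod.mk.injEq] at this
    grind

/-- If every point of `D` lies above `(a, b, c)`, the boundary of the cone of `(a, b, c)` is
initial. -/
theorem IsPast.boundary_mem_initSet (hD : IsPast D t) {a b c : ℤ} (ha : (a, b, c) ∈ D)
    (hle : ∀ g ∈ D, InCone (a, b, c) g) {i j k : ℤ} (hk : |i - a| + |j - b| = k - c)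
    (hu : InCone (i, j, k) t) : (i, j, k) ∈ initSet D := by
  have he := hD.subset_lattice ha
  constructor
  · refine hD.closed _ ha _ ?_ ?_ hu
    · simp only [evenLattice, Set.mem_ofPred_eq, Int.even_iff] at he ⊢
      grind
    · simp only [InCone]
      grind
  · intro h
    have := hle _ h
    simp only [InCone] at this
    grind

end Past

/-! ### Specializations that kill an exchange polynomial -/

section Specialization

open MvPolynomial

variable {D : Set (ℤ × ℤ × ℤ)} {t : ℤ × ℤ × ℤ} {y : ℤ × ℤ × ℤ → RatField D}

/-- The specialization of the initial variable at `v` to `-1` and of all others, as well as of `α`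
and `β`, to `1`. -/
noncomputable def signSpec (D : Set (ℤ × ℤ × ℤ)) (v : ℤ × ℤ × ℤ) :
    MvPolynomial (initSet D) Coeff →+* ℚ :=
  evalAt 1 1 fun g => if g.1 = v then -1 else 1

theorem specializesTo_init {v : ℤ × ℤ × ℤ} (hy : IsOctahedronArray D y) {g : ℤ × ℤ × ℤ}
    (hg : g ∈ initSet D) :
    SpecializesTo (signSpec D v) (y g) (if g = v then (-1 : ℚ) else 1) := by
  have := specializesTo_initVar 1 1 (fun g : initSet D => if g.1 = v then (-1 : ℚ) else 1) ⟨g, hg⟩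
  rwa [← hy.init] at this

theorem specializesTo_init_ne {v : ℤ × ℤ × ℤ} (hy : IsOctahedronArray D y) {g : ℤ × ℤ × ℤ}
    (hg : g ∈ initSet D) (hv : g ≠ v) : SpecializesTo (signSpec D v) (y g) (1 : ℚ) := by
  simpa [hv] using specializesTo_init (v := v) hy hg

theorem specializesTo_step {v : ℤ × ℤ × ℤ} (hy : IsOctahedronArray D y) {i j k : ℤ}
    {e w n s z : ℚ} (h : (i, j, k) ∈ D) (h2 : (i, j, k - 2) ∈ D)
    (he : SpecializesTo (signSpec D v) (y (i + 1, j, k - 1)) e)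
    (hw : SpecializesTo (signSpec D v) (y (i - 1, j, k - 1)) w)
    (hn : SpecializesTo (signSpec D v) (y (i, j + 1, k - 1)) n)
    (hs : SpecializesTo (signSpec D v) (y (i, j - 1, k - 1)) s)
    (hz : SpecializesTo (signSpec D v) (y (i, j, k - 2)) z) (hz0 : z ≠ 0) :
    SpecializesTo (signSpec D v) (y (i, j, k)) ((e * w + n * s) * z⁻¹) := by
  have := (((specializesTo_alpha 1 1 _).mul he).mul hw).add
    (((specializesTo_beta 1 1 _).mul hn).mul hs)
  rw [← hy.recurrence i j k h h2] at this
  simp only [one_mul] at this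
  exact this.of_mul hz hz0

/-- Denominators of an expansion over `D'` come from initial entries of `D'`, so it is enough that
each of these has a nonzero value. -/
theorem laurentSubring_le_fractions_nonvanishing {v : ℤ × ℤ × ℤ} {D' : Set (ℤ × ℤ × ℤ)}
    (h : ∀ g ∈ initSet D', ∃ z : ℚ, z ≠ 0 ∧ SpecializesTo (signSpec D v) (y g) z) :
    laurentSubring D' (alpha D) (beta D) y ≤
      fractionsWithDenom (RatField D) (nonvanishing (signSpec D v)) := by
  refine laurentSubring_le (specializesTo_alpha 1 1 _).mem_fractions
    (specializesTo_beta 1 1 _).mem_fractions fun g hg => ?_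
  obtain ⟨z, hz, h⟩ := h g hg
  exact ⟨h.mem_fractions, (h.inv hz).mem_fractions⟩

/-- Among the neighbours of one of two distinct points there is one that is no neighbour of the
other. -/
theorem exists_neighbor_ne {a b c a' b' c' : ℤ} (h : (a, b, c) ≠ (a', b', c')) :
    ∃ i j : ℤ, |i - a| + |j - b| = 1 ∧
      ∀ i' j' : ℤ, |i' - a'| + |j' - b'| = 1 → (i', j', c' + 1) ≠ (i, j, c + 1) := by
  by_contra! hcon
  have h1 := hcon (a + 1) b (by simp)
  have h2 := hcon (a - 1) b (by simp)
  have h3 := hcon a (b + 1) (by simp)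
  have h4 := hcon a (b - 1) (by simp)
  simp only [Prod.mk.injEq] at *
  grind

/-- The entry two steps above a bottom point, when the specialization does not affect the
neighbours of that point. -/
theorem specializesTo_above_bottom {v : ℤ × ℤ × ℤ} (hD : IsPast D t) (hy : IsOctahedronArray D y)
    {a b c : ℤ} (ha : IsBottom D (a, b, c)) (ha2 : (a, b, c + 2) ∈ D)
    (hv : ∀ i j : ℤ, |i - a| + |j - b| = 1 → (i, j, c + 1) ≠ v) :
    ∃ z : ℚ, z ≠ 0 ∧ SpecializesTo (signSpec D v) (y (a, b, c + 2)) z := by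
  have key : ∀ i j : ℤ, |i - a| + |j - b| = 1 →
      SpecializesTo (signSpec D v) (y (i, j, c + 2 - 1)) (1 : ℚ) := fun i j hij => by
    rw [show c + 2 - 1 = c + 1 by ring]
    exact specializesTo_init_ne hy (hD.neighbor_mem_initSet ha ha2 hij) (hv i j hij)
  have h0 := specializesTo_init (v := v) hy ha.mem_initSet
  have hz : (if (a, b, c) = v then (-1 : ℚ) else 1) ≠ 0 := by split_ifs <;> norm_num
  refine ⟨_, ?_, specializesTo_step hy ha2 (by simpa using ha.1) (key _ _ (by simp))
    (key _ _ (by simp)) (key _ _ (by simp)) (key _ _ (by simp)) (by simpa using h0) hz⟩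
  exact mul_ne_zero (by norm_num) (inv_ne_zero hz)

/-- The numerator of the exchange relation at a bottom point. -/
theorem exists_exchangePoly (hD : IsPast D t) (hy : IsOctahedronArray D y)
    {a b c : ℤ} (ha : IsBottom D (a, b, c)) (ha2 : (a, b, c + 2) ∈ D) :
    ∃ P : MvPolynomial (initSet D) Coeff, Prime P ∧
      y (a, b, c + 2) * y (a, b, c) = algebraMap _ (RatField D) P ∧
      ∀ i j : ℤ, |i - a| + |j - b| = 1 → signSpec D (i, j, c + 1) P = 0 := by
  have hE := hD.neighbor_mem_initSet ha ha2 (i := a + 1) (j := b) (by simp)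
  have hW := hD.neighbor_mem_initSet ha ha2 (i := a - 1) (j := b) (by simp)
  have hN := hD.neighbor_mem_initSet ha ha2 (i := a) (j := b + 1) (by simp)
  have hS := hD.neighbor_mem_initSet ha ha2 (i := a) (j := b - 1) (by simp)
  refine ⟨exchangePoly ⟨_, hE⟩ ⟨_, hW⟩ ⟨_, hN⟩ ⟨_, hS⟩, exchangePoly_prime ?_ ?_ ?_ ?_ ?_, ?_, ?_⟩
  · simp only [ne_eq, Subtype.mk.injEq, Prod.mk.injEq]; omega
  · simp
  · simp
  · simp
  · simp
  · have h := hy.recurrence a b (c + 2) ha2 (by simpa using ha.1)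
    rw [show c + 2 - 1 = c + 1 by ring, show c + 2 - 2 = c by ring] at h
    rw [h, hy.init ⟨_, hE⟩, hy.init ⟨_, hW⟩, hy.init ⟨_, hN⟩, hy.init ⟨_, hS⟩]
    simp only [exchangePoly, initVar, map_add, map_mul, algebraMap_alpha, algebraMap_beta]
  · intro i j hij
    simp only [signSpec, evalAt_exchangePoly, Prod.mk.injEq]
    have : (i = a + 1 ∧ j = b) ∨ (i = a - 1 ∧ j = b) ∨ (i = a ∧ j = b + 1) ∨
        (i = a ∧ j = b - 1) := by grind
    -- Exactly one of the four variables is -1, so the two products are 1 and -1 and cancel.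
    rcases this with ⟨rfl, rfl⟩ | ⟨rfl, rfl⟩ | ⟨rfl, rfl⟩ | ⟨rfl, rfl⟩ <;> grind

end Specialization
/-- The entry four steps above a bottom point has no pole where the entry `Y` two steps above it
vanishes. -/
theorem confinement_identity {K : Type*} [Field K]
    {α β x e w n s Y Z e' w' n' s' ee ww nn ss ne nw se sw : K} (hY : Y ≠ 0)
    (h : Y * x = α * e * w + β * n * s)
    (he : e' * e = α * ee * Y + β * ne * se) (hw : w' * w = α * Y * ww + β * nw * sw)
    (hn : n' * n = α * ne * nw + β * nn * Y) (hs : s' * s = α * se * sw + β * Y * ss)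
    (hZ : Z * Y = α * e' * w' + β * n' * s') :
    Z * (e * w * (n * s)) =
      α * (n * s) * (α * α * Y * ee * ww + α * β * (ee * (nw * sw) + ww * (ne * se))) +
      β * (e * w) * (β * β * Y * nn * ss + α * β * (nn * (se * sw) + ss * (ne * nw))) +
      α * β * (ne * se) * (nw * sw) * x := by
  -- After multiplication by `Y`, the part free of `Y` is `α β ne se nw sw (α e w + β n s)`, and by
  -- `h` the bracket equals `Y * x`.
  apply mul_right_cancel₀ hY
  linear_combination (e * w * (n * s)) * hZ + α * (n * s) * (w' * w) * he +
    α * (n * s) * (α * ee * Y + β * ne * se) * hw + β * (e * w) * (s' * s) * hn +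
    β * (e * w) * (α * ne * nw + β * nn * Y) * hs - α * β * (ne * se) * (nw * sw) * h

/-! ### The Laurent property for finite pasts -/

section Main

open MvPolynomial

variable {D : Set (ℤ × ℤ × ℤ)} {t : ℤ × ℤ × ℤ} {y : ℤ × ℤ × ℤ → RatField D}

theorem init_mem_fractions (hy : IsOctahedronArray D y) {g : ℤ × ℤ × ℤ} (hg : g ∈ initSet D)
    {M : Submonoid (MvPolynomial (initSet D) Coeff)} (hM : monomials (initSet D) ≤ M) :
    y g ∈ fractionsWithDenom (RatField D) M ∧ (y g)⁻¹ ∈ fractionsWithDenom (RatField D) M := by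
  rw [hy.init ⟨g, hg⟩]
  exact ⟨algebraMap_mem_fractionsWithDenom _ _, inv_algebraMap_mem_fractionsWithDenom
    (hM (Submonoid.subset_closure ⟨_, rfl⟩))⟩

/-- Laurent expansions after removing a bottom point involve only one extra denominator. -/
theorem laurentSubring_diff_bottom_le (hy : IsOctahedronArray D y)
    {a b c : ℤ} (ha : IsBottom D (a, b, c)) {P : MvPolynomial (initSet D) Coeff}
    (hne : y (a, b, c) ≠ 0)
    (hP : y (a, b, c + 2) * y (a, b, c) = algebraMap _ (RatField D) P) :
    laurentSubring (D \ {(a, b, c)}) (alpha D) (beta D) y ≤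
      fractionsWithDenom (RatField D) (monomials (initSet D) ⊔ Submonoid.powers P) := by
  refine laurentSubring_le ?_ ?_ fun g hg => ?_
  · rw [← algebraMap_alpha]
    exact algebraMap_mem_fractionsWithDenom _ _
  · rw [← algebraMap_beta]
    exact algebraMap_mem_fractionsWithDenom _ _
  · rcases mem_initSet_diff hg with ⟨hg, -⟩ | ⟨rfl, -⟩
    · exact init_mem_fractions hy hg le_sup_left
    · have h0 := init_mem_fractions hy ha.mem_initSet
        (le_sup_left (b := Submonoid.powers P))
      have hPs := inv_algebraMap_mem_fractionsWithDenom (K := RatField D)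
        (le_sup_right (a := monomials (initSet D)) (Submonoid.mem_powers P))
      rw [(eq_mul_inv_iff_mul_eq₀ hne).2 hP, mul_inv, inv_inv]
      exact ⟨mul_mem (algebraMap_mem_fractionsWithDenom _ _) h0.2, mul_mem hPs h0.1⟩

/-- If `(a, b, c)` lies below all points of `D`, then the entries that become initial after removing
the light cone below `(a, b, c + 2)` do not vanish under a specialization annihilating the entry at
`(a, b, c + 2)`. -/
theorem specializesTo_of_removed_cone (hD : IsPast D t) (hy : IsOctahedronArray D y) {a b c : ℤ}
    (ha : (a, b, c) ∈ D) (hle : ∀ g ∈ D, InCone (a, b, c) g) (ha2 : (a, b, c + 2) ∈ D)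
    {g : ℤ × ℤ × ℤ} (hg : g ∈ initSet {g | g ∈ D ∧ ¬ InCone g (a, b, c + 2)}) :
    ∃ z : ℚ, z ≠ 0 ∧ SpecializesTo (signSpec D (a + 1, b, c + 1)) (y g) z := by
  have hbot : IsBottom D (a, b, c) := ⟨ha, fun g hg h => h.antisymm (hle g hg)⟩
  have hE := hD.neighbor_mem_initSet hbot ha2 (i := a + 1) (j := b) (by simp)
  have hW := hD.neighbor_mem_initSet hbot ha2 (i := a - 1) (j := b) (by simp)
  have hN := hD.neighbor_mem_initSet hbot ha2 (i := a) (j := b + 1) (by simp)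
  have hS := hD.neighbor_mem_initSet hbot ha2 (i := a) (j := b - 1) (by simp)
  set v : ℤ × ℤ × ℤ := (a + 1, b, c + 1) with hv
  have sE : SpecializesTo (signSpec D v) (y (a + 1, b, c + 1)) (-1 : ℚ) := by
    simpa using specializesTo_init (v := v) hy hE
  have sW : SpecializesTo (signSpec D v) (y (a - 1, b, c + 1)) (1 : ℚ) :=
    specializesTo_init_ne hy hW (by simp only [hv, ne_eq, Prod.mk.injEq]; omega)
  have sN : SpecializesTo (signSpec D v) (y (a, b + 1, c + 1)) (1 : ℚ) :=
    specializesTo_init_ne hy hN (by simp [hv])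
  have sS : SpecializesTo (signSpec D v) (y (a, b - 1, c + 1)) (1 : ℚ) :=
    specializesTo_init_ne hy hS (by simp [hv])
  have s0 : SpecializesTo (signSpec D v) (y (a, b, c)) (1 : ℚ) :=
    specializesTo_init_ne hy hbot.mem_initSet (by simp [hv])
  have sY : SpecializesTo (signSpec D v) (y (a, b, c + 2)) (0 : ℚ) := by
    have hc : c + 2 - 1 = c + 1 := by ring
    have hc' : c + 2 - 2 = c := by ring
    have := specializesTo_step (v := v) (i := a) (j := b) (k := c + 2) hy ha2 (by rwa [hc'])
      (by rw [hc]; exact sE) (by rw [hc]; exact sW) (by rw [hc]; exact sN)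
      (by rw [hc]; exact sS) (by rw [hc']; exact s0) one_ne_zero
    simpa using this
  -- Apart from `(a, b, c + 2)`, the points used at height `c + 2` lie on the boundary of the cone
  -- of `(a, b, c)`, hence are initial. The point `g` above them ensures that they lie below `t`.
  have bd : ∀ g ∈ D, ∀ i j : ℤ, ((i = a + 2 ∨ i = a - 2) ∧ j = b ∨ (j = b + 2 ∨ j = b - 2) ∧ i = a ∨
      (i = a + 1 ∨ i = a - 1) ∧ (j = b + 1 ∨ j = b - 1)) → InCone (i, j, c + 2) g →
      SpecializesTo (signSpec D v) (y (i, j, c + 2)) (1 : ℚ) := by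
    intro g hg i j hij hu
    refine specializesTo_init_ne hy (hD.boundary_mem_initSet ha hle ?_
      (hu.trans (hD.inCone_top g hg))) (by simp [hv])
    rcases hij with ⟨rfl | rfl, rfl⟩ | ⟨rfl | rfl, rfl⟩ | ⟨rfl | rfl, rfl | rfl⟩ <;> simp
  have hc1 : c + 3 - 1 = c + 2 := by ring
  have hc2 : c + 3 - 2 = c + 1 := by ring
  have sE' : (a + 1, b, c + 3) ∈ D →
      SpecializesTo (signSpec D v) (y (a + 1, b, c + 3)) (-1 : ℚ) := by
    intro h
    have := specializesTo_step (v := v) (e := 1) (w := 0) (n := 1) (s := 1) (z := -1) hy h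
      (by rw [hc2]; exact hE.1)
      (by rw [hc1]; exact bd _ h _ _ (by omega) (by rw [inCone_iff]; omega))
      (by rw [hc1, add_sub_cancel_right]; exact sY)
      (by rw [hc1]; exact bd _ h _ _ (by omega) (by rw [inCone_iff]; omega))
      (by rw [hc1]; exact bd _ h _ _ (by omega) (by rw [inCone_iff]; omega))
      (by rw [hc2]; exact sE) (by norm_num)
    norm_num at this
    exact this
  have sW' : (a - 1, b, c + 3) ∈ D →
      SpecializesTo (signSpec D v) (y (a - 1, b, c + 3)) (1 : ℚ) := by
    intro h
    have := specializesTo_step (v := v) (e := 0) (w := 1) (n := 1) (s := 1) (z := 1) hy h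
      (by rw [hc2]; exact hW.1)
      (by rw [hc1, sub_add_cancel]; exact sY)
      (by rw [hc1]; exact bd _ h _ _ (by omega) (by rw [inCone_iff]; omega))
      (by rw [hc1]; exact bd _ h _ _ (by omega) (by rw [inCone_iff]; omega))
      (by rw [hc1]; exact bd _ h _ _ (by omega) (by rw [inCone_iff]; omega))
      (by rw [hc2]; exact sW) (by norm_num)
    norm_num at this
    exact this
  have sN' : (a, b + 1, c + 3) ∈ D →
      SpecializesTo (signSpec D v) (y (a, b + 1, c + 3)) (1 : ℚ) := by
    intro h
    have := specializesTo_step (v := v) (e := 1) (w := 1) (n := 1) (s := 0) (z := 1) hy h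
      (by rw [hc2]; exact hN.1)
      (by rw [hc1]; exact bd _ h _ _ (by omega) (by rw [inCone_iff]; omega))
      (by rw [hc1]; exact bd _ h _ _ (by omega) (by rw [inCone_iff]; omega))
      (by rw [hc1]; exact bd _ h _ _ (by omega) (by rw [inCone_iff]; omega))
      (by rw [hc1, add_sub_cancel_right]; exact sY)
      (by rw [hc2]; exact sN) (by norm_num)
    norm_num at this
    exact this
  have sS' : (a, b - 1, c + 3) ∈ D →
      SpecializesTo (signSpec D v) (y (a, b - 1, c + 3)) (1 : ℚ) := by
    intro h
    have := specializesTo_step (v := v) (e := 1) (w := 1) (n := 0) (s := 1) (z := 1) hy h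
      (by rw [hc2]; exact hS.1)
      (by rw [hc1]; exact bd _ h _ _ (by omega) (by rw [inCone_iff]; omega))
      (by rw [hc1]; exact bd _ h _ _ (by omega) (by rw [inCone_iff]; omega))
      (by rw [hc1, sub_add_cancel]; exact sY)
      (by rw [hc1]; exact bd _ h _ _ (by omega) (by rw [inCone_iff]; omega))
      (by rw [hc2]; exact sS) (by norm_num)
    norm_num at this
    exact this
  -- The recurrence specializes to 0/0 here. The confinement identity gives the value instead: its
  -- right side is 2 - 2 + 1 = 1, and `e w n s` takes the value -1.
  have sZ : (a, b, c + 4) ∈ D →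
      SpecializesTo (signSpec D v) (y (a, b, c + 4)) (-1 : ℚ) := by
    intro h
    have hn := hD.isRecurrenceDomain.neighbors a b (c + 4) h
      (by rwa [show c + 4 - 2 = c + 2 by ring])
    have r0 := hy.recurrence a b (c + 2) ha2 (by rwa [show c + 2 - 2 = c by ring])
    have rZ := hy.recurrence a b (c + 4) h (by rwa [show c + 4 - 2 = c + 2 by ring])
    rw [show c + 4 - 1 = c + 3 by ring] at hn rZ
    rw [show c + 4 - 2 = c + 2 by ring] at rZ
    rw [show c + 2 - 1 = c + 1 by ring, show c + 2 - 2 = c by ring] at r0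
    have rE := hy.recurrence (a + 1) b (c + 3) hn.1 (by rw [hc2]; exact hE.1)
    have rW := hy.recurrence (a - 1) b (c + 3) hn.2.1 (by rw [hc2]; exact hW.1)
    have rN := hy.recurrence a (b + 1) (c + 3) hn.2.2.1 (by rw [hc2]; exact hN.1)
    have rS := hy.recurrence a (b - 1) (c + 3) hn.2.2.2 (by rw [hc2]; exact hS.1)
    rw [hc1, hc2, add_sub_cancel_right] at rE rN
    rw [hc1, hc2, sub_add_cancel] at rW rS
    have hY0 := (hy.isSolution hD.isRecurrenceDomain).ne_zero _ ha2
    have key := confinement_identity hY0 r0 rE rW rN rS rZ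
    have sEE := bd _ h (a + 1 + 1) b (by omega) (by rw [inCone_iff]; omega)
    have sWW := bd _ h (a - 1 - 1) b (by omega) (by rw [inCone_iff]; omega)
    have sNN := bd _ h a (b + 1 + 1) (by omega) (by rw [inCone_iff]; omega)
    have sSS := bd _ h a (b - 1 - 1) (by omega) (by rw [inCone_iff]; omega)
    have sNE := bd _ h (a + 1) (b + 1) (by omega) (by rw [inCone_iff]; omega)
    have sSE := bd _ h (a + 1) (b - 1) (by omega) (by rw [inCone_iff]; omega)
    have sNW := bd _ h (a - 1) (b + 1) (by omega) (by rw [inCone_iff]; omega)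
    have sSW := bd _ h (a - 1) (b - 1) (by omega) (by rw [inCone_iff]; omega)
    have sα : SpecializesTo (signSpec D v) (alpha D) (1 : ℚ) := specializesTo_alpha 1 1 _
    have sβ : SpecializesTo (signSpec D v) (beta D) (1 : ℚ) := specializesTo_beta 1 1 _
    have rhs := (((sα.mul (sN.mul sS)).mul ((((sα.mul sα).mul sY).mul sEE).mul sWW |>.add
      ((sα.mul sβ).mul ((sEE.mul (sNW.mul sSW)).add (sWW.mul (sNE.mul sSE)))))).add
      ((sβ.mul (sE.mul sW)).mul ((((sβ.mul sβ).mul sY).mul sNN).mul sSS |>.add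
      ((sα.mul sβ).mul ((sNN.mul (sSE.mul sSW)).add (sSS.mul (sNE.mul sNW))))))).add
      ((((sα.mul sβ).mul (sNE.mul sSE)).mul (sNW.mul sSW)).mul s0)
    rw [← key] at rhs
    have := rhs.of_mul ((sE.mul sW).mul (sN.mul sS)) (by norm_num)
    norm_num at this
    exact this
  obtain ⟨⟨hgD, hgc⟩, hg2⟩ := hg
  by_cases hgi : g ∈ initSet D
  · refine ⟨_, ?_, specializesTo_init hy hgi⟩
    split_ifs <;> norm_num
  obtain ⟨i, j, k⟩ := g
  have hg3 : (i, j, k - 2) ∈ D := by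
    by_contra h
    exact hgi ⟨hgD, h⟩
  have hg4 : InCone (i, j, k - 2) (a, b, c + 2) := by
    by_contra h
    exact hg2 ⟨hg3, h⟩
  have hg5 := hle _ hg3
  have heven := hD.subset_lattice ha
  have heven' := hD.subset_lattice hg3
  -- The point two below `g` is one of the six lattice points between `(a, b, c)` and `(a, b, c +
  -- 2)`; it is not `(a, b, c)`, since `g` is not below `(a, b, c + 2)`.
  have hcases : (i = a ∧ j = b ∧ k = c + 4) ∨ (i = a + 1 ∧ j = b ∧ k = c + 3) ∨
      (i = a - 1 ∧ j = b ∧ k = c + 3) ∨ (i = a ∧ j = b + 1 ∧ k = c + 3) ∨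
      (i = a ∧ j = b - 1 ∧ k = c + 3) := by
    simp only [evenLattice, Set.mem_ofPred_eq, Int.even_iff, inCone_iff] at heven heven' hg4 hg5 hgc
    omega
  rcases hcases with ⟨rfl, rfl, rfl⟩ | ⟨rfl, rfl, rfl⟩ | ⟨rfl, rfl, rfl⟩ | ⟨rfl, rfl, rfl⟩ |
    ⟨rfl, rfl, rfl⟩
  · exact ⟨_, by norm_num, sZ hgD⟩
  · exact ⟨_, by norm_num, sE' hgD⟩
  · exact ⟨_, by norm_num, sW' hgD⟩
  · exact ⟨_, by norm_num, sN' hgD⟩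
  · exact ⟨_, by norm_num, sS' hgD⟩

/-- The inductive step of the Laurent property for the generic array. -/
theorem top_mem_fractions_monomials (hD : IsPast D t) (hy : IsOctahedronArray D y)
    (ht : t ∉ initSet D)
    (hexch : ∀ a b c : ℤ, IsBottom D (a, b, c) → (a, b, c + 2) ∈ D)
    (ih : ∀ D' : Set (ℤ × ℤ × ℤ), D' ⊂ D → IsPast D' t →
      y t ∈ laurentSubring D' (alpha D) (beta D) y) :
    y t ∈ fractionsWithDenom (RatField D) (monomials (initSet D)) := by
  have hsol := hy.isSolution hD.isRecurrenceDomain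
  have hdiff : ∀ a, IsBottom D a → y t ∈ laurentSubring (D \ {a}) (alpha D) (beta D) y := by
    intro a ha
    refine ih _ ⟨Set.sdiff_subset, fun h => (h ha.1).2 rfl⟩ (hD.diff_bottom ha ?_)
    rintro rfl
    exact ht ha.mem_initSet
  obtain ⟨⟨a, b, c⟩, ha⟩ := exists_isBottom_of_finite hD.finite ⟨t, hD.top_mem⟩
  have ha2 := hexch a b c ha
  obtain ⟨P, hP, hyP, hPv⟩ := exists_exchangePoly hD hy ha ha2
  have hm0 := hsol.ne_zero _ ha.1
  have hpole := laurentSubring_diff_bottom_le hy ha hm0 hyP (hdiff _ ha)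
  by_cases hle : ∀ g ∈ D, InCone (a, b, c) g
  · by_cases htop : t = (a, b, c + 2)
    · rw [htop, (eq_mul_inv_iff_mul_eq₀ hm0).2 hyP]
      exact mul_mem (algebraMap_mem_fractionsWithDenom _ _)
        (init_mem_fractions hy ha.mem_initSet le_rfl).2
    · refine mem_fractions_of_mem_sup_powers hP (hPv (a + 1) b (by simp)) hpole ?_
      refine laurentSubring_le_fractions_nonvanishing
        (fun g hg => specializesTo_of_removed_cone hD hy ha.1 hle ha2 hg) (ih _ ?_ ?_)
      · exact ⟨fun g hg => hg.1, fun h => (h ha.1).2 (by simp [InCone])⟩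
      · exact hD.restrict (fun g hg => hg.1)
          ⟨hD.top_mem, fun h => htop (h.antisymm (hD.inCone_top _ ha2))⟩
          fun g hg g' hg' h => ⟨hg', fun h' => hg.2 (h.trans h')⟩
  · push Not at hle
    obtain ⟨g₀, hg₀, hg₀'⟩ := hle
    -- The points of `D` not above `(a, b, c)` are closed under going down in `D`, so a minimal one
    -- among them is minimal in `D`.
    obtain ⟨⟨a', b', c'⟩, ha'⟩ := exists_isBottom_of_finite
      (S := {g | g ∈ D ∧ ¬ InCone (a, b, c) g}) (hD.finite.subset fun g hg => hg.1)
      ⟨g₀, hg₀, hg₀'⟩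
    have hb' : IsBottom D (a', b', c') :=
      ⟨ha'.1.1, fun g hg h => ha'.2 g ⟨hg, fun h' => ha'.1.2 (h'.trans h)⟩ h⟩
    have hne : (a, b, c) ≠ (a', b', c') := by
      intro h
      apply ha'.1.2
      rw [h]
      exact InCone.refl _
    obtain ⟨i, j, hij, hv⟩ := exists_neighbor_ne hne
    refine mem_fractions_of_mem_sup_powers hP (hPv i j hij) hpole ?_
    refine laurentSubring_le_fractions_nonvanishing (fun g hg => ?_) (hdiff _ hb')
    rcases mem_initSet_diff hg with ⟨hg, -⟩ | ⟨rfl, hg⟩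
    · refine ⟨_, ?_, specializesTo_init hy hg⟩
      split_ifs <;> norm_num
    · exact specializesTo_above_bottom hD hy hb' hg hv

/-- The Laurent property for the top entry of a finite array. -/
theorem IsPast.mem_laurentSubring (hD : IsPast D t) {K : Type} [Field K] {α β : K}
    {z : ℤ × ℤ × ℤ → K} (hz : IsSolution D α β z) : z t ∈ laurentSubring D α β z := by
  induction hn : D.ncard using Nat.strong_induction_on generalizing D K with
  | _ n ih =>
    subst hn
    by_cases ht : t ∈ initSet D
    · exact init_mem_laurentSubring ht
    by_cases hexch : ∀ a b c : ℤ, IsBottom D (a, b, c) → (a, b, c + 2) ∈ D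
    · have hrec := hD.isRecurrenceDomain
      have hy := isOctahedronArray_genericArray hrec
      refine hz.mem_laurentSubring_of_generic hrec hy hD.top_mem
        (top_mem_fractions_monomials hD hy ht hexch fun D' hD' hpast => ?_)
      -- The induction hypothesis is used over the field `RatField D`, for the generic array of `D`
      -- restricted to `D'`.
      exact ih _ (Set.ncard_lt_ncard hD' hD.finite) hpast ((hy.isSolution hrec).mono hD'.subset) rfl
    · push Not at hexch
      obtain ⟨a, b, c, ha, ha2⟩ := hexch
      have hlt : D \ {(a, b, c)} ⊂ D := ⟨Set.sdiff_subset, fun h => (h ha.1).2 rfl⟩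
      have hat : (a, b, c) ≠ t := by
        rintro rfl
        exact ht ha.mem_initSet
      refine laurentSubring_mono (fun g hg => ?_) (ih _ (Set.ncard_lt_ncard hlt hD.finite)
        (hD.diff_bottom ha hat) (hz.mono hlt.subset) rfl)
      rcases mem_initSet_diff hg with ⟨hg, -⟩ | ⟨rfl, hg⟩
      · exact hg
      · exact absurd hg ha2

end Main

/-! ### From finite pasts to the index set -/

section IndexSet

variable {H : Set (ℤ × ℤ × ℤ)}

theorem IsIndexSet.isRecurrenceDomain (hH : IsIndexSet H) : IsRecurrenceDomain H where
  neighbors i j k h h2 := by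
    have he := hH.subset_lattice h
    simp only [evenLattice, Set.mem_ofPred_eq, Int.even_iff] at he
    refine ⟨?_, ?_, ?_, ?_⟩ <;> refine hH.cone_closed _ h2 _ ?_ (by rw [inCone_iff]; omega) <;>
      simp only [evenLattice, Set.mem_ofPred_eq, Int.even_iff] <;> omega
  finite_below := hH.finite_below

/-- The points of an index set below a given one. -/
theorem IsIndexSet.isPast (hH : IsIndexSet H) {t : ℤ × ℤ × ℤ} (ht : t ∈ H) :
    IsPast {g | g ∈ H ∧ InCone g t} t where
  top_mem := ⟨ht, InCone.refl t⟩
  finite := hH.finite_below t ht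
  subset_lattice _ hg := hH.subset_lattice hg.1
  inCone_top _ hg := hg.2
  closed g hg g' he h h' := ⟨hH.cone_closed g hg.1 g' he h, h'⟩

/-- Two steps down from a point below `t` is still below `t`, so cutting `H` down to a past creates
no initial points. -/
theorem initSet_past_subset {t : ℤ × ℤ × ℤ} : initSet {g | g ∈ H ∧ InCone g t} ⊆ initSet H := by
  rintro ⟨i, j, k⟩ ⟨⟨h1, h2⟩, h3⟩
  exact ⟨h1, fun h => h3 ⟨h, InCone.trans (by simp [InCone]) h2⟩⟩

theorem IsOctahedronArray.laurentSubring_le_laurentRing {y : ℤ × ℤ × ℤ → RatField H}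
    (hy : IsOctahedronArray H y) :
    laurentSubring H (alpha H) (beta H) y ≤ (laurentRing H).toSubring := by
  refine laurentSubring_le ((laurentRing H).algebraMap_mem _) ((laurentRing H).algebraMap_mem _)
    fun g hg => ?_
  rw [hy.init ⟨g, hg⟩]
  exact ⟨Algebra.subset_adjoin (Or.inl ⟨_, rfl⟩), Algebra.subset_adjoin (Or.inr ⟨_, rfl⟩)⟩

end IndexSet
end Octahedron

theorem theorem1p3 (H : Set (ℤ × ℤ × ℤ)) (hH : Octahedron.IsIndexSet H) :
    (∃ y : ℤ × ℤ × ℤ → Octahedron.RatField H, Octahedron.IsOctahedronArray H y) ∧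
    ∀ y : ℤ × ℤ × ℤ → Octahedron.RatField H, Octahedron.IsOctahedronArray H y →
      ∀ h ∈ H, y h ≠ 0 ∧ y h ∈ Octahedron.laurentRing H := by
  refine ⟨⟨_, Octahedron.isOctahedronArray_genericArray hH.isRecurrenceDomain⟩,
    fun y hy h hh => ?_⟩
  have hsol := hy.isSolution hH.isRecurrenceDomain
  refine ⟨hsol.ne_zero h hh, hy.laurentSubring_le_laurentRing ?_⟩
  exact Octahedron.laurentSubring_mono Octahedron.initSet_past_subset
    ((hH.isPast hh).mem_laurentSubring (hsol.mono fun _ hg => hg.1))
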